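/- Let $d\ge 1$, $1<p<\infty$, and let $D\subset\mathbb{R}^d$ be an open set of finite Lebesgue measure. Let $\mu$ be a $p$-capacitary measure on $\mathbb{R}^d$, i.e. a nonnegative Borel measure (possibly taking the value $+\infty$) such that for every Borel set $E\subset\mathbb{R}^d$: (i) $\operatorname{cap}_p(E)=0$ implies $\mu(E)=0$; (ii) $\mu(E)=\inf\{\mu(A): A\supset E,\ A\ p\text{-quasi open}\}$, where $A$ is $p$-quasi open if $A=\{w>0\}$ for a quasi-continuous representative $w$ of a function in $W^{1,p}(\mathbb{R}^d)$. Here $$\operatorname{cap}_p(E)=\inf\Big\{\int_{\mathbb{R}^d}|\nabla w|^p+|w|^p\,dx:\ w\in W^{1,p}(\mathbb{R}^d),\ w\ge 1\text{ a.e. in a neighbourhood of }E\Big\},$$ and $w$ is quasi-continuous if for every $\varepsilon>0$ there is an open set $U$ with $\operatorname{cap}_p(U)<\varepsilon$ such that $w|_{\mathbb{R}^d\setminus U}$ is continuous. Denote by $W^{1,p}_\mu$ the space of all $u\in W^{1,p}_0(D)$ (extended by zero to $\mathbb{R}^d$ and represented by quasi-continuous functions) with $\int|u|^p\,d\mu<\infty$.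 Let $f\in L^q(D)$ with $1\le q\le\infty$ and $q>d/p$, and let $u=u_{\mu,f}$ be the weak solution of $-\Delta_p u+\mu|u|^{p-2}u=f$ in $D$ with zero Dirichlet condition on $\partial D$, that is, $u\in W^{1,p}_\mu$ and $$\int_D|\nabla u|^{p-2}\nabla u\cdot\nabla v\,dx+\int|u|^{p-2}uv\,d\mu=\int_D fv\,dx\qquad\text{for all }v\in W^{1,p}_\mu .$$ Then $u\in L^\infty(D)$. -/

import Mathlib

open MeasureTheory Filter Topology
open scoped ENNReal ContDiff Gradient

/-- `ℝ^d` with the Euclidean norm. -/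
abbrev Rd (d : ℕ) : Type := EuclideanSpace ℝ (Fin d)

/-- `G` is the weak (distributional) gradient of `u` on `ℝ^d`:
`∫ u ∇φ = - ∫ φ G` for every test function `φ ∈ C_c^∞(ℝ^d)`. -/
def HasWeakGradient {d : ℕ} (u : Rd d → ℝ) (G : Rd d → Rd d) : Prop :=
  LocallyIntegrable u volume ∧ LocallyIntegrable G volume ∧
    ∀ φ : Rd d → ℝ, ContDiff ℝ ∞ φ → HasCompactSupport φ →
      ∫ x, u x • ∇ φ x = - ∫ x, φ x • G x

/-- `u ∈ W^{1,p}(ℝ^d)`, with weak gradient `G`. -/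
def MemW1p {d : ℕ} (p : ℝ) (u : Rd d → ℝ) (G : Rd d → Rd d) : Prop :=
  MemLp u (ENNReal.ofReal p) volume ∧ MemLp G (ENNReal.ofReal p) volume ∧ HasWeakGradient u G

/-- `u ∈ W^{1,p}_0(D)` (extended by zero to `ℝ^d`), with weak gradient `G`: the closure of
`C_c^∞(D)` in `W^{1,p}`. -/
def MemW1pZero {d : ℕ} (p : ℝ) (D : Set (Rd d)) (u : Rd d → ℝ) (G : Rd d → Rd d) : Prop :=
  MemW1p p u G ∧
    ∃ φ : ℕ → Rd d → ℝ,
      (∀ n, ContDiff ℝ ∞ (φ n) ∧ HasCompactSupport (φ n) ∧ tsupport (φ n) ⊆ D) ∧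
      Tendsto (fun n => eLpNorm (fun x => φ n x - u x) (ENNReal.ofReal p) volume) atTop (𝓝 0) ∧
      Tendsto (fun n => eLpNorm (fun x => ∇ (φ n) x - G x) (ENNReal.ofReal p) volume) atTop (𝓝 0)

/-- The Sobolev `p`-capacity of `E`: the infimum of `∫ |∇w|^p + |w|^p` over all
`w ∈ W^{1,p}(ℝ^d)` with `w ≥ 1` a.e. in a neighbourhood of `E`. -/
noncomputable def pCap {d : ℕ} (p : ℝ) (E : Set (Rd d)) : ℝ≥0∞ :=
  ⨅ (w : Rd d → ℝ) (G : Rd d → Rd d) (_ : MemW1p p w G)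
    (_ : ∃ U : Set (Rd d), IsOpen U ∧ E ⊆ U ∧ ∀ᵐ x ∂(volume.restrict U), 1 ≤ w x),
    ∫⁻ x, (‖G x‖ₑ ^ p + ‖w x‖ₑ ^ p)

/-- `u` is `p`-quasi-continuous: its restriction to the complement of open sets of arbitrarily
small capacity is continuous. -/
def IsQuasiContinuous {d : ℕ} (p : ℝ) (u : Rd d → ℝ) : Prop :=
  ∀ ε : ℝ≥0∞, 0 < ε → ∃ U : Set (Rd d), IsOpen U ∧ pCap p U < ε ∧ ContinuousOn u Uᶜ

/-- `A` is `p`-quasi open: `A = {u > 0}` for some `u ∈ W^{1,p}(ℝ^d)`, where Sobolev functions are,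
as usual, represented by quasi-continuous functions. -/
def IsQuasiOpen {d : ℕ} (p : ℝ) (A : Set (Rd d)) : Prop :=
  ∃ (u : Rd d → ℝ) (G : Rd d → Rd d),
    MemW1p p u G ∧ IsQuasiContinuous p u ∧ A = {x | 0 < u x}

/-- `μ` is a `p`-capacitary measure on `ℝ^d`: it may take the value `+∞` (also on compact sets),
it vanishes on Borel sets of zero capacity, and it is outer regular with respect to
`p`-quasi open sets. -/
def IsCapacitary {d : ℕ} (p : ℝ) (μ : Measure (Rd d)) : Prop :=
  ∀ E : Set (Rd d), MeasurableSet E →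
    (pCap p E = 0 → μ E = 0) ∧
    μ E = ⨅ (A : Set (Rd d)) (_ : IsQuasiOpen p A) (_ : E ⊆ A), μ A

/-- `u ∈ W^{1,p}_μ`, with weak gradient `G`: `u` is a quasi-continuous representative of an
element of `W^{1,p}_0(D)`, and `∫ |u|^p dμ < ∞`. -/
def MemW1pMu {d : ℕ} (p : ℝ) (D : Set (Rd d)) (μ : Measure (Rd d))
    (u : Rd d → ℝ) (G : Rd d → Rd d) : Prop :=
  MemW1pZero p D u G ∧ IsQuasiContinuous p u ∧ ∫⁻ x, ‖u x‖ₑ ^ p ∂μ < ⊤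

/-- `u` is a weak solution of `-Δ_p u + μ |u|^{p-2} u = f` in `D`: `u ∈ W^{1,p}_μ` and
`∫_D |∇u|^{p-2} ∇u · ∇v + ∫ |u|^{p-2} u v dμ = ∫_D f v` for every `v ∈ W^{1,p}_μ`. -/
def IsWeakSolution {d : ℕ} (p : ℝ) (D : Set (Rd d)) (μ : Measure (Rd d))
    (f u : Rd d → ℝ) : Prop :=
  ∃ G : Rd d → Rd d, MemW1pMu p D μ u G ∧
    ∀ (v : Rd d → ℝ) (H : Rd d → Rd d), MemW1pMu p D μ v H →
      (∫ x in D, ‖G x‖ ^ (p - 2) * inner ℝ (G x) (H x)) +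
          (∫ x, |u x| ^ (p - 2) * u x * v x ∂μ)
        = ∫ x in D, f x * v x

/-! Stampacchia's truncation method. For `k ≥ 0` the truncation `excess k (u)` is an admissible test
function: it lies in `W^{1,p}_0(D)` with gradient `G` cut off to `{|u| > k}`, it is
quasi-continuous, and it is dominated by `|u|`. The `μ`-term of the tested equation is nonnegative
since `s * excess k s ≥ 0`, so it can be dropped, leaving `‖∇ excess‖_p ^ p ≤ ‖f‖_q ‖excess‖_{q'}`
(`energy_estimate`).

Write `a(k) = |D ∩ {|u| > k}|`. The Sobolev inequality with gradient exponent `1/t ≤ p` and target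
exponent `s`, `1/s = t - 1/d`, combined with Hölder on the level set on both sides of the energy
estimate, bounds `‖excess‖_s` by a power of `a(k)`. Chebyshev's inequality turns this into `(l - k)
a(l)^c ≤ K a(k)^b` with `c = 1/s`. The condition `b > c` is exactly `1/q < p/d`, whatever the
admissible `t`. By `stampacchia_lemma` such a superlinear recursion forces `a` to vanish at a finite
level, so `u` is bounded.

This covers `p ≤ d`. For `p > d` the bound comes from Sobolev regularity alone: the same recursion
with the fixed norm of `G` when `d ≥ 2`, and the fundamental theorem of calculus when `d = 1`. -/

/-! ### Convergence in Lebesgue spaces, test functions, integration by parts -/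

theorem tendsto_eLpNorm_zero_of_dominated {α E : Type*} [MeasurableSpace α] {ν : Measure α}
    [NormedAddCommGroup E] {p : ℝ≥0∞} (hp0 : p ≠ 0) (hp : p ≠ ⊤) {F : ℕ → α → E} {g : α → ℝ}
    (hg : MemLp g p ν) (hF : ∀ n, AEStronglyMeasurable (F n) ν)
    (hb : ∀ n, ∀ᵐ x ∂ν, ‖F n x‖ ≤ ‖g x‖)
    (hl : ∀ᵐ x ∂ν, Tendsto (fun n => F n x) atTop (𝓝 0)) :
    Tendsto (fun n => eLpNorm (F n) p ν) atTop (𝓝 0) := by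
  have hpos : 0 < p.toReal := ENNReal.toReal_pos hp0 hp
  simp_rw [eLpNorm_eq_lintegral_rpow_enorm_toReal hp0 hp]
  have h1 : Tendsto (fun n => ∫⁻ x, ‖F n x‖ₑ ^ p.toReal ∂ν) atTop (𝓝 (∫⁻ _, 0 ∂ν)) := by
    refine tendsto_lintegral_of_dominated_convergence' (fun x => ‖g x‖ₑ ^ p.toReal)
      (fun n => (hF n).enorm.pow_const _) ?_ ?_ ?_
    · intro n
      filter_upwards [hb n] with x hx
      gcongr
      exact enorm_le_iff_norm_le.2 hx
    · exact (lintegral_rpow_enorm_lt_top_of_eLpNorm_lt_top hp0 hp hg.2).ne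
    · filter_upwards [hl] with x hx
      have h2 := (hx.enorm).ennrpow_const p.toReal
      simpa [hpos] using h2
  have h2 := h1.ennrpow_const (1 / p.toReal)
  simpa [hpos] using h2

/-- A smooth function with compact support contained in `D`. -/
def IsTestFunction {d : ℕ} (D : Set (Rd d)) (φ : Rd d → ℝ) : Prop :=
  ContDiff ℝ ∞ φ ∧ HasCompactSupport φ ∧ tsupport φ ⊆ D

theorem gradient_eq_toDual_symm {d : ℕ} (φ : Rd d → ℝ) :
    ∇ φ = fun x => (InnerProductSpace.toDual ℝ (Rd d)).symm (fderiv ℝ φ x) := rfl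

theorem inner_gradient {d : ℕ} (φ : Rd d → ℝ) (x w : Rd d) :
    inner ℝ (∇ φ x) w = fderiv ℝ φ x w := by
  simp [gradient_eq_toDual_symm]

theorem continuous_gradient {d : ℕ} {φ : Rd d → ℝ} (h : ContDiff ℝ ∞ φ) : Continuous (∇ φ) := by
  rw [gradient_eq_toDual_symm]
  exact (LinearIsometryEquiv.continuous _).comp (h.continuous_fderiv (by simp))

theorem support_gradient_subset {d : ℕ} (φ : Rd d → ℝ) :
    Function.support (∇ φ) ⊆ tsupport φ := by
  refine Set.Subset.trans ?_ (support_fderiv_subset ℝ)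
  intro x hx hx'
  apply hx
  simp [gradient_eq_toDual_symm, hx']

theorem hasCompactSupport_gradient {d : ℕ} {φ : Rd d → ℝ} (h : HasCompactSupport φ) :
    HasCompactSupport (∇ φ) :=
  HasCompactSupport.of_support_subset_isCompact h (support_gradient_subset φ)

theorem integral_smul_gradient_of_contDiff {d : ℕ} {φ ψ : Rd d → ℝ} (hφ : ContDiff ℝ ∞ φ)
    (hφs : HasCompactSupport φ) (hψ : ContDiff ℝ ∞ ψ) (hψs : HasCompactSupport ψ) :
    ∫ x, ψ x • ∇ φ x = - ∫ x, φ x • ∇ ψ x := by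
  have i1 : Integrable (fun x => ψ x • ∇ φ x) volume :=
    (hψ.continuous.smul (continuous_gradient hφ)).integrable_of_hasCompactSupport hψs.smul_right
  have i2 : Integrable (fun x => φ x • ∇ ψ x) volume :=
    (hφ.continuous.smul (continuous_gradient hψ)).integrable_of_hasCompactSupport hφs.smul_right
  refine ext_inner_left ℝ fun w => ?_
  rw [inner_neg_right, ← integral_inner i1, ← integral_inner i2]
  have e1 : ∀ x, inner ℝ w (ψ x • ∇ φ x) = ψ x * fderiv ℝ φ x w := fun x => by
    rw [inner_smul_right, real_inner_comm, inner_gradient]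
  have e2 : ∀ x, inner ℝ w (φ x • ∇ ψ x) = fderiv ℝ ψ x w * φ x := fun x => by
    rw [inner_smul_right, real_inner_comm, inner_gradient, mul_comm]
  have j1 := i1.const_inner (𝕜 := ℝ) w
  have j2 := i2.const_inner (𝕜 := ℝ) w
  simp_rw [e1] at j1 ⊢
  simp_rw [e2] at j2 ⊢
  exact integral_mul_fderiv_eq_neg_fderiv_mul_of_integrable j2 j1
    ((hψ.continuous.mul hφ.continuous).integrable_of_hasCompactSupport hψs.mul_right)
    (fun x _ => (hψ.differentiable (by simp)) x) (fun x _ => (hφ.differentiable (by simp)) x)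

theorem tendsto_integral_smul_of_tendsto_eLpNorm {α E : Type*} [MeasurableSpace α] {ν : Measure α}
    [NormedAddCommGroup E] [NormedSpace ℝ E] {p p' : ℝ≥0∞} [ENNReal.HolderConjugate p p']
    {F : ℕ → α → ℝ} {f : α → ℝ} {Φ : α → E} (hF : ∀ n, MemLp (F n) p ν) (hf : MemLp f p ν)
    (hΦ : MemLp Φ p' ν) (h : Tendsto (fun n => eLpNorm (fun x => F n x - f x) p ν) atTop (𝓝 0)) :
    Tendsto (fun n => ∫ x, F n x • Φ x ∂ν) atTop (𝓝 (∫ x, f x • Φ x ∂ν)) := by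
  refine tendsto_integral_of_L1' _ (hf.1.smul hΦ.1)
    (Eventually.of_forall fun n => memLp_one_iff_integrable.1 (hΦ.smul (hF n))) ?_
  have hb : ∀ n, eLpNorm ((fun x => F n x • Φ x) - fun x => f x • Φ x) 1 ν
      ≤ eLpNorm (fun x => F n x - f x) p ν * eLpNorm Φ p' ν := fun n => by
    rw [show ((fun x => F n x • Φ x) - fun x => f x • Φ x) = (fun x => F n x - f x) • Φ by
      ext x; simp [sub_smul]]
    exact eLpNorm_smul_le_mul_eLpNorm hΦ.1 ((hF n).1.sub hf.1)
  refine tendsto_of_tendsto_of_tendsto_of_le_of_le tendsto_const_nhds ?_ (fun _ => zero_le) hb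
  simpa using ENNReal.Tendsto.mul_const h (Or.inr hΦ.2.ne)

theorem tendsto_integral_smul_of_tendsto_eLpNorm' {α E : Type*} [MeasurableSpace α] {ν : Measure α}
    [NormedAddCommGroup E] [NormedSpace ℝ E] {p p' : ℝ≥0∞} [ENNReal.HolderConjugate p' p]
    {F : ℕ → α → E} {f : α → E} {Φ : α → ℝ} (hF : ∀ n, MemLp (F n) p ν) (hf : MemLp f p ν)
    (hΦ : MemLp Φ p' ν) (h : Tendsto (fun n => eLpNorm (fun x => F n x - f x) p ν) atTop (𝓝 0)) :
    Tendsto (fun n => ∫ x, Φ x • F n x ∂ν) atTop (𝓝 (∫ x, Φ x • f x ∂ν)) := by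
  refine tendsto_integral_of_L1' _ (hΦ.1.smul hf.1)
    (Eventually.of_forall fun n => memLp_one_iff_integrable.1 ((hF n).smul hΦ)) ?_
  have hb : ∀ n, eLpNorm ((fun x => Φ x • F n x) - fun x => Φ x • f x) 1 ν
      ≤ eLpNorm Φ p' ν * eLpNorm (fun x => F n x - f x) p ν := fun n => by
    rw [show ((fun x => Φ x • F n x) - fun x => Φ x • f x) = Φ • (fun x => F n x - f x) by
      ext x; simp [smul_sub]]
    exact eLpNorm_smul_le_mul_eLpNorm ((hF n).1.sub hf.1) hΦ.1
  refine tendsto_of_tendsto_of_tendsto_of_le_of_le tendsto_const_nhds ?_ (fun _ => zero_le) hb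
  simpa using ENNReal.Tendsto.const_mul h (Or.inr hΦ.2.ne)

/-! ### Closedness of `W^{1,p}_0(D)` and the chain rule -/

section Closure

variable {d : ℕ} {p : ℝ} {D : Set (Rd d)} {u : Rd d → ℝ} {G : Rd d → Rd d}

/-- The point to prove is that `G` is the weak gradient of `u`: integration by parts holds for each
test function, and by Hölder both sides pass to the limit. -/
theorem memW1pZero_of_tendsto_testFunction (hp : 1 < p) (hu : MemLp u (ENNReal.ofReal p) volume)
    (hG : MemLp G (ENNReal.ofReal p) volume) {φ : ℕ → Rd d → ℝ} (hφ : ∀ n, IsTestFunction D (φ n))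
    (h1 : Tendsto (fun n => eLpNorm (fun x => φ n x - u x) (ENNReal.ofReal p) volume) atTop (𝓝 0))
    (h2 : Tendsto (fun n => eLpNorm (fun x => ∇ (φ n) x - G x) (ENNReal.ofReal p) volume) atTop
      (𝓝 0)) :
    MemW1pZero p D u G := by
  have hp1 : 1 ≤ ENNReal.ofReal p := by simpa using hp.le
  refine ⟨⟨hu, hG, hu.locallyIntegrable hp1, hG.locallyIntegrable hp1, fun ψ hψ hψs => ?_⟩,
    φ, hφ, h1, h2⟩
  have hc : ENNReal.HolderConjugate (ENNReal.ofReal p) (ENNReal.ofReal p.conjExponent) :=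
    (Real.HolderConjugate.conjExponent hp).ennrealOfReal
  have hc' := hc.symm
  have t1 := tendsto_integral_smul_of_tendsto_eLpNorm (p' := ENNReal.ofReal p.conjExponent)
    (Φ := ∇ ψ) (fun n => (hφ n).1.continuous.memLp_of_hasCompactSupport (hφ n).2.1) hu
    ((continuous_gradient hψ).memLp_of_hasCompactSupport (hasCompactSupport_gradient hψs)) h1
  have t2 := tendsto_integral_smul_of_tendsto_eLpNorm' (p' := ENNReal.ofReal p.conjExponent)
    (Φ := ψ) (fun n => (continuous_gradient (hφ n).1).memLp_of_hasCompactSupport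
      (hasCompactSupport_gradient (hφ n).2.1)) hG
    (hψ.continuous.memLp_of_hasCompactSupport hψs) h2
  refine tendsto_nhds_unique t1 ?_
  simp_rw [fun n => integral_smul_gradient_of_contDiff hψ hψs (hφ n).1 (hφ n).2.1]
  exact t2.neg

/-- Diagonal argument: replace each `w n` by a test function within `1/(n+1)` in both norms. -/
theorem memW1pZero_of_tendsto (hp : 1 < p) (hu : MemLp u (ENNReal.ofReal p) volume)
    (hG : MemLp G (ENNReal.ofReal p) volume) {w : ℕ → Rd d → ℝ} {W : ℕ → Rd d → Rd d}
    (hw : ∀ n, MemW1pZero p D (w n) (W n))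
    (h1 : Tendsto (fun n => eLpNorm (fun x => w n x - u x) (ENNReal.ofReal p) volume) atTop (𝓝 0))
    (h2 : Tendsto (fun n => eLpNorm (fun x => W n x - G x) (ENNReal.ofReal p) volume) atTop
      (𝓝 0)) :
    MemW1pZero p D u G := by
  have hp1 : 1 ≤ ENNReal.ofReal p := by simpa using hp.le
  have key : ∀ n : ℕ, ∃ φ, IsTestFunction D φ ∧
      eLpNorm (fun x => φ x - w n x) (ENNReal.ofReal p) volume ≤ ((n : ℝ≥0∞) + 1)⁻¹ ∧
      eLpNorm (fun x => ∇ φ x - W n x) (ENNReal.ofReal p) volume ≤ ((n : ℝ≥0∞) + 1)⁻¹ := fun n => by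
    obtain ⟨-, φ, hφ, t1, t2⟩ := hw n
    have hpos : (0 : ℝ≥0∞) < ((n : ℝ≥0∞) + 1)⁻¹ := by simp
    obtain ⟨m, hm1, hm2⟩ := ((t1.eventually_le_const hpos).and (t2.eventually_le_const hpos)).exists
    exact ⟨φ m, hφ m, hm1, hm2⟩
  choose φ hφ hφ1 hφ2 using key
  have hinv : Tendsto (fun n : ℕ => ((n : ℝ≥0∞) + 1)⁻¹) atTop (𝓝 0) := by
    have := (tendsto_add_atTop_iff_nat 1).2 ENNReal.tendsto_inv_nat_nhds_zero
    simpa using this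
  refine memW1pZero_of_tendsto_testFunction hp hu hG hφ ?_ ?_
  · have hs := hinv.add h1
    rw [add_zero] at hs
    refine tendsto_of_tendsto_of_tendsto_of_le_of_le tendsto_const_nhds hs (fun _ => zero_le)
      fun n => ?_
    have hφm := (hφ n).1.continuous.aestronglyMeasurable (μ := volume)
    have := eLpNorm_add_le (hφm.sub (hw n).1.1.1) ((hw n).1.1.1.sub hu.1) hp1
    rw [sub_add_sub_cancel] at this
    exact this.trans (add_le_add_left (hφ1 n) _)
  · have hs := hinv.add h2
    rw [add_zero] at hs
    refine tendsto_of_tendsto_of_tendsto_of_le_of_le tendsto_const_nhds hs (fun _ => zero_le)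
      fun n => ?_
    have hφm := (continuous_gradient (hφ n).1).aestronglyMeasurable (μ := volume)
    have := eLpNorm_add_le (hφm.sub (hw n).1.2.1.1) ((hw n).1.2.1.1.sub hG.1) hp1
    rw [sub_add_sub_cancel] at this
    exact this.trans (add_le_add_left (hφ2 n) _)

/-- The approximating test functions may be chosen to converge almost everywhere. -/
theorem MemW1pZero.exists_seq_ae_tendsto (hp : 1 < p) (hu : MemW1pZero p D u G) :
    ∃ φ : ℕ → Rd d → ℝ, (∀ n, IsTestFunction D (φ n)) ∧
      (∀ᵐ x, Tendsto (fun n => φ n x) atTop (𝓝 (u x))) ∧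
      Tendsto (fun n => eLpNorm (fun x => φ n x - u x) (ENNReal.ofReal p) volume) atTop (𝓝 0) ∧
      Tendsto (fun n => eLpNorm (fun x => ∇ (φ n) x - G x) (ENNReal.ofReal p) volume) atTop
        (𝓝 0) := by
  obtain ⟨hW, φ, hφ, t1, t2⟩ := hu
  have hp0 : ENNReal.ofReal p ≠ 0 := by simp; linarith
  obtain ⟨ns, hns, hae⟩ := (tendstoInMeasure_of_tendsto_eLpNorm hp0
    (fun n => (hφ n).1.continuous.aestronglyMeasurable) hW.1.1 t1).exists_seq_tendsto_ae
  exact ⟨fun n => φ (ns n), fun n => hφ _, hae, t1.comp hns.tendsto_atTop,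
    t2.comp hns.tendsto_atTop⟩

theorem gradient_comp {F : ℝ → ℝ} {φ : Rd d → ℝ} {x : Rd d} (hF : DifferentiableAt ℝ F (φ x))
    (hφ : DifferentiableAt ℝ φ x) :
    ∇ (fun y => F (φ y)) x = deriv F (φ x) • ∇ φ x := by
  refine ext_inner_right ℝ fun w => ?_
  have := (hF.hasDerivAt.comp_hasFDerivAt x hφ.hasFDerivAt).fderiv
  rw [inner_gradient, inner_smul_left, inner_gradient]
  change fderiv ℝ (F ∘ φ) x w = _
  rw [this]
  simp

theorem IsTestFunction.comp {φ : Rd d → ℝ} (hφ : IsTestFunction D φ) {F : ℝ → ℝ}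
    (hF : ContDiff ℝ ∞ F) (hF0 : F 0 = 0) : IsTestFunction D (fun x => F (φ x)) :=
  ⟨hF.comp hφ.1, hφ.2.1.comp_left hF0, (tsupport_comp_subset hF0 φ).trans hφ.2.2⟩

/-- If test functions `φ n` approximate `u`, then `F ∘ φ n` are test functions because `F 0 = 0`,
and they approximate `F ∘ u` because `F` is 1-Lipschitz. -/
theorem MemW1pZero.comp_contDiff (hp : 1 < p) (hu : MemW1pZero p D u G) {F : ℝ → ℝ}
    (hF : ContDiff ℝ ∞ F) (hF0 : F 0 = 0) (hF' : ∀ s, |deriv F s| ≤ 1) :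
    MemW1pZero p D (fun x => F (u x)) (fun x => deriv F (u x) • G x) := by
  have hp1 : 1 ≤ ENNReal.ofReal p := by simpa using hp.le
  have hp0 : ENNReal.ofReal p ≠ 0 := by simp; linarith
  obtain ⟨φ, hφ, hae, t1, t2⟩ := hu.exists_seq_ae_tendsto hp
  obtain ⟨⟨hum, hGm, -⟩, -⟩ := hu
  have hFd : Differentiable ℝ F := hF.differentiable (by simp)
  have hFc : Continuous (deriv F) := hF.continuous_deriv (by simp)
  have hlip : ∀ s t, |F s - F t| ≤ |s - t| := fun s t => by
    simpa using convex_univ.norm_image_sub_le_of_norm_deriv_le (𝕜 := ℝ) (f := F) (C := 1)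
      (fun x _ => hFd x) (fun x _ => hF' x) (Set.mem_univ t) (Set.mem_univ s)
  have mFu : AEStronglyMeasurable (fun x => F (u x)) volume :=
    hF.continuous.comp_aestronglyMeasurable hum.1
  have mF'u : AEStronglyMeasurable (fun x => deriv F (u x)) volume :=
    hFc.comp_aestronglyMeasurable hum.1
  have mφ : ∀ n, AEStronglyMeasurable (fun x => deriv F (φ n x)) volume := fun n =>
    (hFc.comp (hφ n).1.continuous).aestronglyMeasurable
  have mgφ : ∀ n, AEStronglyMeasurable (∇ (φ n)) volume := fun n =>
    (continuous_gradient (hφ n).1).aestronglyMeasurable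
  refine memW1pZero_of_tendsto_testFunction hp (hum.mono mFu ?_) (hGm.mono (mF'u.smul hGm.1) ?_)
    (fun n => (hφ n).comp hF hF0) ?_ ?_
  · exact Eventually.of_forall fun x => by simpa [hF0] using hlip (u x) 0
  · refine Eventually.of_forall fun x => ?_
    rw [norm_smul]
    exact mul_le_of_le_one_left (norm_nonneg _) (hF' _)
  · refine tendsto_of_tendsto_of_tendsto_of_le_of_le tendsto_const_nhds t1 (fun _ => zero_le)
      fun n => eLpNorm_mono fun x => hlip _ _
  -- `deriv F` need not be Lipschitz, so this part of the gradient error is handled by almost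
  -- everywhere convergence and the majorant `2‖G‖`.
  · have h3 : Tendsto (fun n => eLpNorm (fun x => (deriv F (φ n x) - deriv F (u x)) • G x)
        (ENNReal.ofReal p) volume) atTop (𝓝 0) := by
      refine tendsto_eLpNorm_zero_of_dominated (g := fun x => 2 * ‖G x‖) hp0 ENNReal.ofReal_ne_top
        (hGm.norm.const_mul 2) (fun n => ((mφ n).sub mF'u).smul hGm.1) (fun n => ?_) ?_
      · refine Eventually.of_forall fun x => ?_
        rw [norm_smul, norm_mul, norm_norm]
        gcongr
        have := abs_sub (deriv F (φ n x)) (deriv F (u x))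
        have h1 := hF' (φ n x)
        have h2 := hF' (u x)
        simp only [Real.norm_eq_abs, Nat.abs_ofNat]
        linarith
      · filter_upwards [hae] with x hx
        have := ((hFc.tendsto (u x)).comp hx).sub_const (deriv F (u x))
        simpa using this.smul_const (G x)
    have hs := t2.add h3
    rw [add_zero] at hs
    refine tendsto_of_tendsto_of_tendsto_of_le_of_le tendsto_const_nhds hs (fun _ => zero_le)
      fun n => ?_
    have e : (fun x => ∇ (fun y => F (φ n y)) x - deriv F (u x) • G x)
        = (fun x => deriv F (φ n x) • (∇ (φ n) x - G x))
          + fun x => (deriv F (φ n x) - deriv F (u x)) • G x := by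
      ext1 x
      rw [gradient_comp (hFd _) ((hφ n).1.differentiable (by simp) x)]
      simp only [Pi.add_apply, smul_sub, sub_smul]
      abel
    rw [e]
    refine (eLpNorm_add_le ((mφ n).smul ((mgφ n).sub hGm.1))
      (((mφ n).sub mF'u).smul hGm.1) hp1).trans ?_
    refine add_le_add (eLpNorm_mono fun x => ?_) le_rfl
    rw [Pi.smul_apply', norm_smul]
    exact mul_le_of_le_one_left (norm_nonneg _) (hF' _)

/-- Composition with a Lipschitz function that is a limit of smooth functions, together with the
derivatives. -/
theorem MemW1pZero.comp_of_tendsto (hp : 1 < p) (hu : MemW1pZero p D u G) {F : ℕ → ℝ → ℝ}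
    {T θ : ℝ → ℝ} (hF : ∀ n, ContDiff ℝ ∞ (F n)) (hF0 : ∀ n, F n 0 = 0)
    (hF' : ∀ n s, |deriv (F n) s| ≤ 1) (hT : ∀ s, Tendsto (fun n => F n s) atTop (𝓝 (T s)))
    (hθ : ∀ s, Tendsto (fun n => deriv (F n) s) atTop (𝓝 (θ s))) :
    MemW1pZero p D (fun x => T (u x)) (fun x => θ (u x) • G x) := by
  have hp0 : ENNReal.ofReal p ≠ 0 := by simp; linarith
  have hw := fun n => hu.comp_contDiff hp (hF n) (hF0 n) (hF' n)
  obtain ⟨⟨hum, hGm, -⟩, -⟩ := hu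
  have hle : ∀ n s, |F n s| ≤ |s| := fun n s => by
    simpa [hF0 n] using convex_univ.norm_image_sub_le_of_norm_deriv_le (𝕜 := ℝ) (f := F n) (C := 1)
      (fun x _ => (hF n).differentiable (by simp) x) (fun x _ => hF' n x)
      (Set.mem_univ 0) (Set.mem_univ s)
  have hTle : ∀ s, |T s| ≤ |s| := fun s => le_of_tendsto' (hT s).abs fun n => hle n s
  have hθle : ∀ s, |θ s| ≤ 1 := fun s => le_of_tendsto' (hθ s).abs fun n => hF' n s
  have mT : AEStronglyMeasurable (fun x => T (u x)) volume :=
    aestronglyMeasurable_of_tendsto_ae atTop (fun n => (hw n).1.1.1)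
      (Eventually.of_forall fun x => hT (u x))
  have mθ : AEStronglyMeasurable (fun x => θ (u x) • G x) volume :=
    aestronglyMeasurable_of_tendsto_ae atTop (fun n => (hw n).1.2.1.1)
      (Eventually.of_forall fun x => (hθ (u x)).smul_const (G x))
  refine memW1pZero_of_tendsto hp (hum.mono mT (Eventually.of_forall fun x => hTle _))
    (hGm.mono mθ (Eventually.of_forall fun x => ?_)) hw ?_ ?_
  · rw [norm_smul]
    exact mul_le_of_le_one_left (norm_nonneg _) (hθle _)
  · refine tendsto_eLpNorm_zero_of_dominated (g := fun x => 2 * u x) hp0 ENNReal.ofReal_ne_top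
      (hum.const_mul 2) (fun n => (hw n).1.1.1.sub mT) (fun n => Eventually.of_forall fun x => ?_)
      (Eventually.of_forall fun x => ?_)
    · have := abs_sub (F n (u x)) (T (u x))
      have h1 := hle n (u x)
      have h2 := hTle (u x)
      simp only [Real.norm_eq_abs, abs_mul, Nat.abs_ofNat]
      linarith
    · simpa using (hT (u x)).sub_const (T (u x))
  · refine tendsto_eLpNorm_zero_of_dominated (g := fun x => 2 * ‖G x‖) hp0 ENNReal.ofReal_ne_top
      (hGm.norm.const_mul 2) (fun n => (hw n).1.2.1.1.sub mθ)
      (fun n => Eventually.of_forall fun x => ?_) (Eventually.of_forall fun x => ?_)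
    · rw [← sub_smul, norm_smul, norm_mul, norm_norm]
      gcongr
      have := abs_sub (deriv (F n) (u x)) (θ (u x))
      have h1 := hF' n (u x)
      have h2 := hθle (u x)
      simp only [Real.norm_eq_abs, Nat.abs_ofNat]
      linarith
    · simpa using ((hθ (u x)).smul_const (G x)).sub_const (θ (u x) • G x)

end Closure

/-! ### The truncation function and its smooth approximation -/

/-- Truncation at level `k`: the odd function with value `s - k` at `s ≥ k` and `0` on `[-k, k]`. -/
def excess (k s : ℝ) : ℝ := s - max (-k) (min s k)

theorem excess_of_abs_le {k s : ℝ} (h : |s| ≤ k) : excess k s = 0 := by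
  rw [abs_le] at h
  rw [excess, min_eq_left h.2, max_eq_right h.1, sub_self]

theorem excess_of_le {k s : ℝ} (hk : 0 ≤ k) (h : k ≤ s) : excess k s = s - k := by
  rw [excess, min_eq_right h, max_eq_right (by linarith)]

theorem excess_of_le_neg {k s : ℝ} (hk : 0 ≤ k) (h : s ≤ -k) : excess k s = s + k := by
  rw [excess, min_eq_left (by linarith), max_eq_left h, sub_neg_eq_add]

theorem continuous_excess (k : ℝ) : Continuous (excess k) := by
  unfold excess; fun_prop

theorem sub_le_abs_excess {k s : ℝ} (hk : 0 ≤ k) : |s| - k ≤ |excess k s| := by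
  rcases le_total |s| k with h | h
  · exact (sub_nonpos.2 h).trans (abs_nonneg _)
  · rcases le_abs'.1 h with h | h
    · rw [excess_of_le_neg hk h, abs_of_nonpos (by linarith), abs_of_nonpos (by linarith)]
      linarith
    · rw [excess_of_le hk h, abs_of_nonneg (by linarith), abs_of_nonneg (by linarith)]

theorem mul_excess_nonneg {k : ℝ} (hk : 0 ≤ k) (s : ℝ) : 0 ≤ s * excess k s := by
  rcases le_total |s| k with h | h
  · rw [excess_of_abs_le h, mul_zero]
  · rcases le_abs'.1 h with h | h
    · rw [excess_of_le_neg hk h]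
      exact mul_nonneg_of_nonpos_of_nonpos (by linarith) (by linarith)
    · rw [excess_of_le hk h]
      exact mul_nonneg (by linarith) (by linarith)

theorem abs_excess_le {k : ℝ} (hk : 0 ≤ k) (s : ℝ) : |excess k s| ≤ |s| := by
  rcases le_total |s| k with h | h
  · simp [excess_of_abs_le h]
  · rcases le_abs'.1 h with h | h
    · rw [excess_of_le_neg hk h, abs_of_nonpos (by linarith), abs_of_nonpos (by linarith)]
      linarith
    · rw [excess_of_le hk h, abs_of_nonneg (by linarith), abs_of_nonneg (by linarith)]
      linarith

theorem hasDerivAt_excess {k t : ℝ} (hk : 0 ≤ k) (h : |t| ≠ k) :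
    HasDerivAt (excess k) ({t | k < |t|}.indicator 1 t) t := by
  rcases lt_or_gt_of_ne h with h | h
  · rw [Set.indicator_of_notMem (by simpa using h.le)]
    refine (hasDerivAt_const t (0 : ℝ)).congr_of_eventuallyEq ?_
    filter_upwards [(isOpen_Iio.preimage continuous_abs).mem_nhds h] with y hy
    exact excess_of_abs_le (le_of_lt hy)
  · rw [Set.indicator_of_mem (by simpa using h)]
    rcases lt_abs.1 h with h | h
    · refine ((hasDerivAt_id t).sub_const k).congr_of_eventuallyEq ?_
      filter_upwards [isOpen_Ioi.mem_nhds h] with y hy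
      exact excess_of_le hk (le_of_lt hy)
    · refine ((hasDerivAt_id t).add_const k).congr_of_eventuallyEq ?_
      filter_upwards [isOpen_Iio.mem_nhds (show t < -k by linarith)] with y hy
      exact excess_of_le_neg hk (le_of_lt hy)

theorem intervalIntegral_indicator_eq_excess {k : ℝ} (hk : 0 ≤ k) (s : ℝ) :
    ∫ t in (0 : ℝ)..s, {t | k < |t|}.indicator (1 : ℝ → ℝ) t = excess k s := by
  have hmeas : MeasurableSet {t : ℝ | k < |t|} :=
    measurableSet_lt measurable_const continuous_abs.measurable
  have := MeasureTheory.integral_eq_of_hasDerivAt_off_countable (a := 0) (b := s) (excess k)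
    ({t | k < |t|}.indicator 1) (s := {k, -k}) (Set.to_countable _)
    (continuous_excess k).continuousOn
    (fun x hx => hasDerivAt_excess hk fun h => hx.2 (by
      rcases abs_choice x with h' | h' <;> simp only [Set.mem_insert_iff, Set.mem_singleton_iff]
      · left; linarith
      · right; linarith)) ?_
  · rw [this, excess_of_abs_le (k := k) (s := 0) (by simpa using hk), sub_zero]
  · refine (intervalIntegrable_const (c := (1 : ℝ))).mono_fun
      ((measurable_one.indicator hmeas).aestronglyMeasurable) (Eventually.of_forall fun x => ?_)
    by_cases hx : k < |x| <;> simp [Set.indicator, hx]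

/-- Smooth approximation of `excess k`. -/
noncomputable def smoothExcess (k : ℝ) (n : ℕ) (s : ℝ) : ℝ :=
  ∫ t in (0 : ℝ)..s, Real.smoothTransition (n * (t ^ 2 - k ^ 2))

theorem contDiff_smoothExcess_deriv (k : ℝ) (n : ℕ) :
    ContDiff ℝ ∞ fun t : ℝ => Real.smoothTransition (n * (t ^ 2 - k ^ 2)) :=
  Real.smoothTransition.contDiff.comp
    (contDiff_const.mul ((contDiff_id.pow 2).sub contDiff_const))

theorem hasDerivAt_smoothExcess (k : ℝ) (n : ℕ) (s : ℝ) :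
    HasDerivAt (smoothExcess k n) (Real.smoothTransition (n * (s ^ 2 - k ^ 2))) s :=
  (contDiff_smoothExcess_deriv k n).continuous.integral_hasStrictDerivAt 0 s |>.hasDerivAt

theorem deriv_smoothExcess (k : ℝ) (n : ℕ) :
    deriv (smoothExcess k n) = fun t : ℝ => Real.smoothTransition (n * (t ^ 2 - k ^ 2)) :=
  funext fun s => (hasDerivAt_smoothExcess k n s).deriv

theorem contDiff_smoothExcess (k : ℝ) (n : ℕ) : ContDiff ℝ ∞ (smoothExcess k n) := by
  rw [contDiff_infty_iff_deriv]
  refine ⟨fun s => (hasDerivAt_smoothExcess k n s).differentiableAt, ?_⟩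
  rw [deriv_smoothExcess]
  exact contDiff_smoothExcess_deriv k n

/-- The transition is `0` for every `n` when `|s| ≤ k`, including the corners `|s| = k`. The limit
thus exists at every point, and the chain rule needs no knowledge of the gradient on `{|u| = k}`. -/
theorem tendsto_deriv_smoothExcess {k : ℝ} (hk : 0 ≤ k) (s : ℝ) :
    Tendsto (fun n : ℕ => Real.smoothTransition (n * (s ^ 2 - k ^ 2))) atTop
      (𝓝 ({t | k < |t|}.indicator 1 s)) := by
  rcases le_or_gt |s| k with h | h
  · rw [Set.indicator_of_notMem (by simpa using h)]
    refine tendsto_const_nhds.congr fun n => ?_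
    have : s ^ 2 ≤ k ^ 2 := sq_le_sq' (abs_le.1 h).1 (abs_le.1 h).2
    rw [Real.smoothTransition.zero_of_nonpos]
    exact mul_nonpos_of_nonneg_of_nonpos n.cast_nonneg (by linarith)
  · rw [Set.indicator_of_mem (by simpa using h)]
    have hpos : 0 < s ^ 2 - k ^ 2 := by
      rw [← sq_abs s]; nlinarith
    have hT : Tendsto (fun n : ℕ => (n : ℝ) * (s ^ 2 - k ^ 2)) atTop atTop :=
      tendsto_natCast_atTop_atTop.atTop_mul_const hpos
    refine tendsto_const_nhds.congr' ?_
    filter_upwards [hT.eventually_ge_atTop 1] with n hn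
    rw [Real.smoothTransition.one_of_one_le hn, Pi.one_apply]

theorem tendsto_smoothExcess {k : ℝ} (hk : 0 ≤ k) (s : ℝ) :
    Tendsto (fun n => smoothExcess k n s) atTop (𝓝 (excess k s)) := by
  rw [← intervalIntegral_indicator_eq_excess hk]
  refine intervalIntegral.tendsto_integral_filter_of_dominated_convergence (fun _ => 1)
    (Eventually.of_forall fun n =>
      (contDiff_smoothExcess_deriv k n).continuous.aestronglyMeasurable)
    (Eventually.of_forall fun n => Eventually.of_forall fun x _ => ?_) (by simp)
    (Eventually.of_forall fun x _ => tendsto_deriv_smoothExcess hk x)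
  rw [Real.norm_eq_abs, abs_of_nonneg (Real.smoothTransition.nonneg _)]
  exact Real.smoothTransition.le_one _

theorem MemW1pZero.excess {d : ℕ} {p : ℝ} {D : Set (Rd d)} {u : Rd d → ℝ} {G : Rd d → Rd d}
    (hp : 1 < p) (hu : MemW1pZero p D u G) {k : ℝ} (hk : 0 ≤ k) :
    MemW1pZero p D (fun x => excess k (u x)) ({x | k < |u x|}.indicator G) := by
  have := hu.comp_of_tendsto hp (F := smoothExcess k) (T := _root_.excess k)
    (θ := {t | k < |t|}.indicator 1) (contDiff_smoothExcess k)
    (fun n => by simp [smoothExcess]) (fun n s => ?_) (tendsto_smoothExcess hk) fun s => ?_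
  · convert this using 1
    ext1 x
    by_cases hx : k < |u x| <;> simp [Set.indicator, hx]
  · rw [deriv_smoothExcess, abs_of_nonneg (Real.smoothTransition.nonneg _)]
    exact Real.smoothTransition.le_one _
  · simp_rw [deriv_smoothExcess]
    exact tendsto_deriv_smoothExcess hk s

/-! ### Sobolev inequalities -/

theorem enorm_gradient {d : ℕ} (φ : Rd d → ℝ) (x : Rd d) : ‖∇ φ x‖ₑ = ‖fderiv ℝ φ x‖ₑ := by
  rw [← ofReal_norm, ← ofReal_norm, gradient_eq_toDual_symm,
    LinearIsometryEquiv.norm_map]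

/-- A Sobolev inequality for compactly supported smooth functions extends to `W^{1,p}_0(D)` when
`D` has finite measure and the gradient is measured in an exponent `r ≤ p`. -/
theorem MemW1pZero.eLpNorm_le {d : ℕ} {p : ℝ} (hp : 1 < p) {D : Set (Rd d)}
    (hD : volume D < ⊤) {r C : NNReal} {s : ℝ≥0∞} (hr1 : 1 ≤ r) (hrp : (r : ℝ) ≤ p)
    (hC : ∀ φ : Rd d → ℝ, ContDiff ℝ ∞ φ → HasCompactSupport φ →
      eLpNorm φ s volume ≤ C * eLpNorm (∇ φ) r volume)
    {v : Rd d → ℝ} {H : Rd d → Rd d} (hv : MemW1pZero p D v H) :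
    eLpNorm v s (volume.restrict D) ≤ C * eLpNorm H r (volume.restrict D) := by
  obtain ⟨φ, hφ, hae, -, t2⟩ := hv.exists_seq_ae_tendsto hp
  have hfin : IsFiniteMeasure (volume.restrict D) := ⟨by simpa using hD⟩
  have hr1' : (1 : ℝ≥0∞) ≤ r := by exact_mod_cast hr1
  have hrp' : (r : ℝ≥0∞) ≤ ENNReal.ofReal p := by
    rw [ENNReal.le_ofReal_iff_toReal_le (by simp) (by linarith)]
    simpa using hrp
  have mg : ∀ n, AEStronglyMeasurable (∇ (φ n)) (volume.restrict D) := fun n =>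
    (continuous_gradient (hφ n).1).aestronglyMeasurable
  have mH : AEStronglyMeasurable H (volume.restrict D) := hv.1.2.1.1.restrict
  have hsob : ∀ n, eLpNorm (φ n) s (volume.restrict D)
      ≤ C * eLpNorm (∇ (φ n)) r (volume.restrict D) := fun n => by
    rw [eLpNorm_restrict_eq_of_support_subset
      ((support_gradient_subset (φ n)).trans (hφ n).2.2)]
    exact (eLpNorm_restrict_le _ _ _ _).trans (hC _ (hφ n).1 (hφ n).2.1)
  -- Finite measure of `D` and `r ≤ p` turn `L^p` convergence of the gradients into `L^r`
  -- convergence.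
  have hr : Tendsto (fun n => eLpNorm (∇ (φ n) - H) r (volume.restrict D)) atTop (𝓝 0) := by
    have hc : Tendsto (fun n => eLpNorm (fun x => ∇ (φ n) x - H x) (ENNReal.ofReal p) volume *
        (volume.restrict D) Set.univ ^ (1 / (r : ℝ≥0∞).toReal - 1 / (ENNReal.ofReal p).toReal))
        atTop (𝓝 0) := by
      have := ENNReal.Tendsto.mul_const t2 (b := (volume.restrict D) Set.univ ^
        (1 / (r : ℝ≥0∞).toReal - 1 / (ENNReal.ofReal p).toReal)) (Or.inr ?_)
      · simpa using this
      · refine (ENNReal.rpow_lt_top_of_nonneg ?_ (measure_ne_top _ _)).ne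
        rw [ENNReal.toReal_ofReal (by linarith), ENNReal.coe_toReal, sub_nonneg]
        exact one_div_le_one_div_of_le (lt_of_lt_of_le one_pos (by exact_mod_cast hr1)) hrp
    refine tendsto_of_tendsto_of_tendsto_of_le_of_le tendsto_const_nhds hc (fun _ => zero_le)
      fun n => (eLpNorm_le_eLpNorm_mul_rpow_measure_univ hrp' ((mg n).sub mH)).trans ?_
    gcongr
    exact eLpNorm_restrict_le _ _ _ _
  have hbd : ∀ n, eLpNorm (φ n) s (volume.restrict D)
      ≤ C * (eLpNorm H r (volume.restrict D) + eLpNorm (∇ (φ n) - H) r (volume.restrict D)) :=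
    fun n => (hsob n).trans (by
      gcongr
      simpa using eLpNorm_add_le mH ((mg n).sub mH) hr1')
  have hlim : Tendsto (fun n => C * (eLpNorm H r (volume.restrict D)
      + eLpNorm (∇ (φ n) - H) r (volume.restrict D))) atTop
      (𝓝 (C * eLpNorm H r (volume.restrict D))) := by
    have := ENNReal.Tendsto.const_mul (a := (C : ℝ≥0∞))
      (hr.const_add (eLpNorm H r (volume.restrict D))) (Or.inr ENNReal.coe_ne_top)
    simpa using this
  -- Fatou: no convergence of `φ n` in `L^s` is required, only almost everywhere.
  calc eLpNorm v s (volume.restrict D)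
      ≤ liminf (fun n => eLpNorm (φ n) s (volume.restrict D)) atTop :=
        Lp.eLpNorm_lim_le_liminf_eLpNorm
          (fun n => (hφ n).1.continuous.aestronglyMeasurable) v (ae_restrict_of_ae hae)
    _ ≤ liminf (fun n => C * (eLpNorm H r (volume.restrict D)
          + eLpNorm (∇ (φ n) - H) r (volume.restrict D))) atTop :=
        liminf_le_liminf (Eventually.of_forall hbd)
    _ = _ := hlim.liminf_eq

theorem eLpNorm_le_eLpNorm_gradient {d : ℕ} (hd : 0 < d) {r s : NNReal} (hr1 : 1 ≤ r)
    (hs : (s : ℝ)⁻¹ = (r : ℝ)⁻¹ - (d : ℝ)⁻¹) {φ : Rd d → ℝ} (hφ : ContDiff ℝ ∞ φ)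
    (hφs : HasCompactSupport φ) :
    eLpNorm φ s volume
      ≤ SNormLESNormFDerivOfEqConst ℝ (volume : Measure (Rd d)) r * eLpNorm (∇ φ) r volume := by
  refine (eLpNorm_le_eLpNorm_fderiv_of_eq volume (hφ.of_le (by simp)) hφs hr1
    (by simpa using hd) (by simpa using hs)).trans_eq ?_
  congr 1
  exact eLpNorm_congr_enorm_ae (Eventually.of_forall fun x => (enorm_gradient φ x).symm)

/-- In dimension one a compactly supported `C¹` function is bounded by the `L¹` norm of its
gradient. -/
theorem enorm_le_lintegral_enorm_gradient {φ : Rd 1 → ℝ} (hφ : ContDiff ℝ ∞ φ)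
    (hs : HasCompactSupport φ) (x : Rd 1) : ‖φ x‖ₑ ≤ ∫⁻ y, ‖∇ φ y‖ₑ := by
  let e : ℝ ≃ₗᵢ[ℝ] Rd 1 := (OrthonormalBasis.singleton (Fin 1) ℝ).repr
  have he : ContDiff ℝ 1 fun t => φ (e t) := (hφ.of_le (by simp)).comp e.contDiff
  have hes : HasCompactSupport fun t => φ (e t) :=
    hs.comp_homeomorph e.toHomeomorph
  have hderiv : ∀ t, ‖deriv (fun t => φ (e t)) t‖ₑ ≤ ‖∇ φ (e t)‖ₑ := fun t => by
    have h1 : HasDerivAt (fun t => φ (e t)) (fderiv ℝ φ (e t) (e 1)) t :=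
      ((hφ.differentiable (by simp) (e t)).hasFDerivAt).comp_hasDerivAt t
        (e.toContinuousLinearEquiv.toContinuousLinearMap.hasDerivAt)
    rw [h1.deriv, enorm_gradient, enorm_le_iff_norm_le]
    simpa using (fderiv ℝ φ (e t)).le_opNorm (e 1)
  obtain ⟨t, rfl⟩ := e.surjective x
  calc ‖φ (e t)‖ₑ ≤ ∫⁻ y in Set.Iic t, ‖deriv (fun t => φ (e t)) y‖ₑ :=
        HasCompactSupport.enorm_le_lintegral_Ici_deriv he hes t
    _ ≤ ∫⁻ y, ‖deriv (fun t => φ (e t)) y‖ₑ := setLIntegral_le_lintegral _ _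
    _ ≤ ∫⁻ y, ‖∇ φ (e y)‖ₑ := lintegral_mono hderiv
    _ = ∫⁻ y, ‖∇ φ y‖ₑ := by
        have hmp : MeasurePreserving e volume volume := e.measurePreserving
        exact hmp.lintegral_comp_emb e.toHomeomorph.measurableEmbedding fun y => ‖∇ φ y‖ₑ

/-! ### Decay of level sets -/

/-- Iterate along levels `k₀ + M (1 - 2⁻ⁿ)`. Halving the gaps costs a factor `2` at each step, which
the superlinear power `β` more than recovers: `ψ` decays geometrically along these levels, hence
vanishes at `k₀ + M` by monotonicity. -/
theorem stampacchia_lemma {ψ : ℝ → ℝ} {k₀ K β : ℝ} (hK : 0 ≤ K) (hβ : 1 < β)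
    (hψ : ∀ k, 0 ≤ ψ k) (hanti : Antitone ψ)
    (h : ∀ k l, k₀ ≤ k → k < l → (l - k) * ψ l ≤ K * ψ k ^ β) :
    ∃ k, k₀ ≤ k ∧ ψ k = 0 := by
  rcases (hψ k₀).eq_or_lt with h0 | h0
  · exact ⟨k₀, le_rfl, h0.symm⟩
  set γ : ℝ := 1 / (β - 1) with hγ
  have hγpos : 0 < γ := by rw [hγ]; exact one_div_pos.2 (by linarith)
  have hγβ : γ * β = γ + 1 := by rw [hγ]; field_simp [sub_ne_zero.2 hβ.ne']; ring
  -- The ratio solving `q ^ β = q / 2`; the spare `1/2` pays for the halved gap.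
  set q : ℝ := (2 : ℝ) ^ (-γ) with hq
  have hqpos : 0 < q := by positivity
  have hq1 : q < 1 := Real.rpow_lt_one_of_one_lt_of_neg (by norm_num) (by linarith)
  have hqβ : q ^ β = q / 2 := by
    rw [hq, ← Real.rpow_mul (by norm_num), neg_mul, hγβ, neg_add, Real.rpow_add (by norm_num),
      Real.rpow_neg_one]
    ring
  -- Large enough to close the induction through `hMK`; the `+ 1` keeps `M` positive when `K = 0`.
  set M : ℝ := 2 * K * ψ k₀ ^ (β - 1) / q + 1 with hM
  have hMK : 2 * K * ψ k₀ ^ (β - 1) ≤ M * q := by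
    rw [hM, add_mul, div_mul_cancel₀ _ hqpos.ne']; linarith
  have hMpos : 0 < M := by positivity
  set κ : ℕ → ℝ := fun n => k₀ + M * (1 - (1 / 2) ^ n) with hκ
  have hκ0 : ∀ n, k₀ ≤ κ n := fun n => by
    have : (1 / 2 : ℝ) ^ n ≤ 1 := pow_le_one₀ (by norm_num) (by norm_num)
    have := mul_nonneg hMpos.le (sub_nonneg.2 this)
    simp only [hκ]; linarith
  have hstep : ∀ n, ψ (κ n) ≤ ψ k₀ * q ^ n := by
    intro n
    induction n with
    | zero => simp [hκ]
    | succ n ih =>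
      have hdiff : κ (n + 1) - κ n = M / 2 * (1 / 2) ^ n := by simp only [hκ]; ring
      have hp : (0 : ℝ) < (1 / 2) ^ n := by positivity
      have h1 := h (κ n) (κ (n + 1)) (hκ0 n) (by
        have : 0 < M / 2 * (1 / 2 : ℝ) ^ n := by positivity
        linarith)
      rw [hdiff] at h1
      have h2 : ψ (κ n) ^ β ≤ ψ k₀ * ψ k₀ ^ (β - 1) * (q ^ n * (1 / 2) ^ n) := by
        calc ψ (κ n) ^ β ≤ (ψ k₀ * q ^ n) ^ β :=
              Real.rpow_le_rpow (hψ _) ih (by linarith)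
          _ = _ := by
            rw [Real.mul_rpow h0.le (by positivity)]
            congr 1
            · nth_rewrite 2 [← Real.rpow_one (ψ k₀)]
              rw [← Real.rpow_add h0]; congr 1; ring
            · rw [← Real.rpow_natCast, ← Real.rpow_mul hqpos.le, mul_comm (n : ℝ),
                Real.rpow_mul hqpos.le, hqβ, Real.rpow_natCast, Real.rpow_natCast, ← mul_pow]
              congr 1; ring
      have h3 : M / 2 * (1 / 2) ^ n * ψ (κ (n + 1))
          ≤ M / 2 * (1 / 2) ^ n * (ψ k₀ * q ^ (n + 1)) := by
        calc _ ≤ K * ψ (κ n) ^ β := h1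
          _ ≤ K * (ψ k₀ * ψ k₀ ^ (β - 1) * (q ^ n * (1 / 2) ^ n)) := by gcongr
          _ = (2 * K * ψ k₀ ^ (β - 1)) * (ψ k₀ * q ^ n * (1 / 2) ^ n / 2) := by ring
          _ ≤ (M * q) * (ψ k₀ * q ^ n * (1 / 2) ^ n / 2) := by gcongr
          _ = _ := by ring
      exact le_of_mul_le_mul_left h3 (by positivity)
  refine ⟨k₀ + M, by linarith, le_antisymm ?_ (hψ _)⟩
  have hlim : Tendsto (fun n : ℕ => ψ k₀ * q ^ n) atTop (𝓝 0) := by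
    simpa using (tendsto_pow_atTop_nhds_zero_of_lt_one hqpos.le hq1).const_mul (ψ k₀)
  refine ge_of_tendsto' hlim fun n => (hanti ?_).trans (hstep n)
  have : M * (1 - (1 / 2 : ℝ) ^ n) ≤ M * 1 := by
    gcongr
    have : (0 : ℝ) < (1 / 2) ^ n := by positivity
    linarith
  simp only [hκ]; linarith

theorem eLpNorm_le_mul_measure_rpow_of_support_subset {α E : Type*} [MeasurableSpace α]
    {ν : Measure α} [NormedAddCommGroup E] {f : α → E} {S : Set α} {r p : ℝ≥0∞} (hrp : r ≤ p)
    (hf : AEStronglyMeasurable f ν) (hS : Function.support f ⊆ S) :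
    eLpNorm f r ν ≤ eLpNorm f p ν * ν S ^ (1 / r.toReal - 1 / p.toReal) := by
  have h := eLpNorm_le_eLpNorm_mul_rpow_measure_univ hrp (hf.restrict (s := S))
  rwa [Measure.restrict_apply_univ, eLpNorm_restrict_eq_of_support_subset hS,
    eLpNorm_restrict_eq_of_support_subset hS] at h

/-- Chebyshev's inequality, since `|excess k (u)| ≥ l - k` on `{|u| > l}`. -/
theorem sub_mul_measureReal_rpow_le {α : Type*} [MeasurableSpace α] {ν : Measure α}
    [IsFiniteMeasure ν] {u : α → ℝ} (hu : AEStronglyMeasurable u ν) {s : NNReal} (hs : s ≠ 0)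
    {k l : ℝ} (hk : 0 ≤ k) (hkl : k ≤ l)
    (hv : eLpNorm (fun x => excess k (u x)) s ν ≠ ⊤) :
    (l - k) * ν.real {x | l < |u x|} ^ (s : ℝ)⁻¹
      ≤ (eLpNorm (fun x => excess k (u x)) s ν).toReal := by
  have hspos : (0 : ℝ) < s := by positivity
  have h1 := mul_meas_ge_le_pow_eLpNorm' ν (p := s) (by simpa using hs) ENNReal.coe_ne_top
    ((continuous_excess k).comp_aestronglyMeasurable hu) (ENNReal.ofReal (l - k))
  have h2 : ν {x | l < |u x|} ≤ ν {x | ENNReal.ofReal (l - k) ≤ ‖excess k (u x)‖ₑ} := by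
    refine measure_mono fun x (hx : l < |u x|) => ?_
    rw [Set.mem_ofPred_eq, ← ofReal_norm]
    refine ENNReal.ofReal_le_ofReal (le_trans ?_ (sub_le_abs_excess hk))
    linarith
  have h3 := (mul_le_mul_right h2 (ENNReal.ofReal (l - k) ^ (s : ℝ))).trans h1
  have h4 := ENNReal.toReal_mono (ENNReal.rpow_ne_top_of_nonneg (by simp) hv) h3
  rw [ENNReal.toReal_mul, ← ENNReal.toReal_rpow, ← ENNReal.toReal_rpow,
    ENNReal.toReal_ofReal (by linarith), ENNReal.coe_toReal] at h4
  have h5 := Real.rpow_le_rpow (by positivity) h4 (inv_nonneg.2 hspos.le)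
  rwa [Real.mul_rpow (by have := sub_nonneg.2 hkl; positivity) ENNReal.toReal_nonneg,
    Real.rpow_rpow_inv (sub_nonneg.2 hkl) hspos.ne',
    Real.rpow_rpow_inv ENNReal.toReal_nonneg hspos.ne'] at h5

theorem memLp_top_of_level_set_decay {α : Type*} [MeasurableSpace α] {ν : Measure α}
    [IsFiniteMeasure ν] {u : α → ℝ} (hu : AEStronglyMeasurable u ν) {K c b : ℝ} (hK : 0 ≤ K)
    (hc : 0 < c) (hcb : c < b)
    (h : ∀ k l, 0 ≤ k → k < l →
      (l - k) * ν.real {x | l < |u x|} ^ c ≤ K * ν.real {x | k < |u x|} ^ b) :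
    MemLp u ⊤ ν := by
  obtain ⟨k, -, hk⟩ := stampacchia_lemma (ψ := fun k => ν.real {x | k < |u x|} ^ c) (k₀ := 0)
    (β := b / c) hK ((one_lt_div hc).2 hcb) (fun k => by positivity)
    (fun k l hkl => Real.rpow_le_rpow measureReal_nonneg
      (measureReal_mono fun x (hx : l < |u x|) => hkl.trans_lt hx) hc.le)
    (fun k l hk hkl => by
      rw [← Real.rpow_mul measureReal_nonneg, mul_div_cancel₀ _ hc.ne']
      exact h k l hk hkl)
  rw [Real.rpow_eq_zero measureReal_nonneg hc.ne', measureReal_eq_zero_iff] at hk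
  refine memLp_top_of_bound hu k ?_
  rw [ae_iff]
  simpa using hk

/-- Eliminates the gradient norm `M` between the Sobolev bound `h1` and the energy bound `h2`. The
result is `N ^ p` bounded by a multiple of `N`; one factor `N` cancels and a `(p - 1)`-th root
remains. -/
theorem rpow_bound_of_energy {p N M a C Φ e₁ e₂ : ℝ} (hp : 1 < p) (hN : 0 ≤ N) (hM : 0 ≤ M)
    (ha : 0 ≤ a) (hC : 0 ≤ C) (hΦ : 0 ≤ Φ) (he₁ : 0 ≤ e₁) (he₂ : 0 ≤ e₂)
    (h1 : N ≤ C * (M * a ^ e₁)) (h2 : M ^ p ≤ Φ * (N * a ^ e₂)) :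
    N ≤ (C ^ p * Φ) ^ (p - 1)⁻¹ * a ^ ((p * e₁ + e₂) / (p - 1)) := by
  rcases hN.eq_or_lt with rfl | hN
  · positivity
  have hp1 : 0 < p - 1 := by linarith
  have h3 : N ^ (p - 1) * N ≤ C ^ p * Φ * a ^ (p * e₁ + e₂) * N := by
    calc N ^ (p - 1) * N = N ^ p := by
          rw [← Real.rpow_add_one hN.ne', sub_add_cancel]
      _ ≤ (C * (M * a ^ e₁)) ^ p := Real.rpow_le_rpow hN.le h1 (by linarith)
      _ = C ^ p * (M ^ p * a ^ (p * e₁)) := by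
          rw [Real.mul_rpow hC (by positivity), Real.mul_rpow hM (by positivity),
            ← Real.rpow_mul ha, mul_comm e₁]
      _ ≤ C ^ p * (Φ * (N * a ^ e₂) * a ^ (p * e₁)) := by gcongr
      _ = _ := by
          rw [Real.rpow_add_of_nonneg ha (by positivity) he₂]; ring
  have h4 := Real.rpow_le_rpow (by positivity) (le_of_mul_le_mul_right h3 hN)
    (inv_nonneg.2 hp1.le)
  rwa [Real.rpow_rpow_inv hN.le hp1.ne', Real.mul_rpow (by positivity) (by positivity),
    ← Real.rpow_mul ha, ← div_eq_mul_inv] at h4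

/-! ### Testing the equation with truncations -/

section WeakSolution

variable {d : ℕ} {p : ℝ} {D : Set (Rd d)} {μ : Measure (Rd d)} {u : Rd d → ℝ} {G : Rd d → Rd d}

theorem IsQuasiContinuous.comp {F : ℝ → ℝ} (hF : Continuous F) (hu : IsQuasiContinuous p u) :
    IsQuasiContinuous p fun x => F (u x) := fun ε hε => by
  obtain ⟨U, hU, hUε, hc⟩ := hu ε hε
  exact ⟨U, hU, hUε, hF.comp_continuousOn hc⟩

theorem MemW1pMu.excess (hp : 1 < p) (hu : MemW1pMu p D μ u G) {k : ℝ} (hk : 0 ≤ k) :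
    MemW1pMu p D μ (fun x => _root_.excess k (u x)) ({x | k < |u x|}.indicator G) := by
  refine ⟨hu.1.excess hp hk, hu.2.1.comp (continuous_excess k), lt_of_le_of_lt ?_ hu.2.2⟩
  refine lintegral_mono fun x => ENNReal.rpow_le_rpow ?_ (by linarith)
  exact enorm_le_iff_norm_le.2 (abs_excess_le hk _)

theorem norm_rpow_sub_two_mul_inner_self {E : Type*} [NormedAddCommGroup E]
    [InnerProductSpace ℝ E] (hp : 0 < p) (x : E) : ‖x‖ ^ (p - 2) * inner ℝ x x = ‖x‖ ^ p := by
  rcases eq_or_ne x 0 with rfl | hx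
  · simp [Real.zero_rpow hp.ne']
  · have hx' : 0 < ‖x‖ := norm_pos_iff.2 hx
    rw [real_inner_self_eq_norm_sq, ← Real.rpow_natCast, ← Real.rpow_add hx']
    congr 1
    push_cast; ring

/-- The energy estimate obtained by testing the equation with the truncation of the solution. -/
theorem energy_estimate (hp : 1 < p) {q q' : ℝ≥0∞} [ENNReal.HolderConjugate q q'] {f : Rd d → ℝ}
    (hf : MemLp f q (volume.restrict D)) (hu : MemW1pMu p D μ u G) {k : ℝ} (hk : 0 ≤ k)
    (h : (∫ x in D, ‖G x‖ ^ (p - 2) * inner ℝ (G x) ({x | k < |u x|}.indicator G x)) +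
          (∫ x, |u x| ^ (p - 2) * u x * excess k (u x) ∂μ) = ∫ x in D, f x * excess k (u x)) :
    eLpNorm ({x | k < |u x|}.indicator G) (ENNReal.ofReal p) (volume.restrict D) ^ p
      ≤ eLpNorm f q (volume.restrict D)
        * eLpNorm (fun x => excess k (u x)) q' (volume.restrict D) := by
  have hp0 : ENNReal.ofReal p ≠ 0 := by simp; linarith
  have hvH := (hu.1.excess hp hk).1
  have hH : MemLp ({x | k < |u x|}.indicator G) (ENNReal.ofReal p) (volume.restrict D) :=
    hvH.2.1.restrict D
  have hint := hH.integrable_norm_rpow hp0 ENNReal.ofReal_ne_top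
  rw [ENNReal.toReal_ofReal (by linarith)] at hint
  have hpt : ∀ x, ‖G x‖ ^ (p - 2) * inner ℝ (G x) ({x | k < |u x|}.indicator G x)
      = ‖{x | k < |u x|}.indicator G x‖ ^ p := fun x => by
    by_cases hx : x ∈ {x | k < |u x|}
    · rw [Set.indicator_of_mem hx, norm_rpow_sub_two_mul_inner_self (by linarith)]
    · rw [Set.indicator_of_notMem hx, inner_zero_right, mul_zero, norm_zero,
        Real.zero_rpow (by linarith)]
  -- The absorption term has a favourable sign and is discarded in `hle`.
  have hμ : 0 ≤ ∫ x, |u x| ^ (p - 2) * u x * excess k (u x) ∂μ :=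
    integral_nonneg fun x => by
      simp only [Pi.zero_apply]
      rw [mul_assoc]
      exact mul_nonneg (by positivity) (mul_excess_nonneg hk _)
  simp_rw [hpt] at h
  have hle : ∫ x in D, ‖{x | k < |u x|}.indicator G x‖ ^ p ≤ ‖∫ x in D, f x * excess k (u x)‖ :=
    (by linarith : _ ≤ ∫ x in D, f x * excess k (u x)).trans (le_abs_self _)
  calc eLpNorm ({x | k < |u x|}.indicator G) (ENNReal.ofReal p) (volume.restrict D) ^ p
      = ∫⁻ x in D, ‖{x | k < |u x|}.indicator G x‖ₑ ^ p := by
        rw [eLpNorm_eq_lintegral_rpow_enorm_toReal hp0 ENNReal.ofReal_ne_top,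
          ENNReal.toReal_ofReal (by linarith), ← ENNReal.rpow_mul,
          one_div_mul_cancel (by linarith), ENNReal.rpow_one]
    _ = ENNReal.ofReal (∫ x in D, ‖{x | k < |u x|}.indicator G x‖ ^ p) := by
        rw [ofReal_integral_eq_lintegral_ofReal hint
          (Eventually.of_forall fun x => by positivity)]
        refine lintegral_congr fun x => ?_
        rw [← ENNReal.ofReal_rpow_of_nonneg (norm_nonneg _) (by linarith), ofReal_norm]
    _ ≤ ENNReal.ofReal ‖∫ x in D, f x * excess k (u x)‖ := ENNReal.ofReal_le_ofReal hle
    _ = ‖∫ x in D, f x * excess k (u x)‖ₑ := ofReal_norm _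
    _ ≤ ∫⁻ x in D, ‖f x * excess k (u x)‖ₑ := enorm_integral_le_lintegral_enorm _
    _ = eLpNorm (f • fun x => excess k (u x)) 1 (volume.restrict D) := by
        rw [eLpNorm_one_eq_lintegral_enorm]; rfl
    _ ≤ _ := eLpNorm_smul_le_mul_eLpNorm hvH.1.1.restrict hf.1

/-! ### Boundedness in the different ranges of `p` and `d` -/

theorem memLp_top_of_memW1pZero_dim_one {p : ℝ} (hp : 1 < p) {D : Set (Rd 1)}
    (hD : volume D < ⊤) {u : Rd 1 → ℝ} {G : Rd 1 → Rd 1} (hu : MemW1pZero p D u G) :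
    MemLp u ⊤ (volume.restrict D) := by
  have hfin : IsFiniteMeasure (volume.restrict D) := ⟨by simpa using hD⟩
  have h := hu.eLpNorm_le hp hD (r := 1) (C := 1) (s := ⊤) le_rfl (by simpa using hp.le)
    fun φ hφ hφs => by
      rw [ENNReal.coe_one, one_mul, eLpNorm_one_eq_lintegral_enorm, eLpNorm_exponent_top]
      exact eLpNormEssSup_le_of_ae_enorm_bound
        (Eventually.of_forall fun x => enorm_le_lintegral_enorm_gradient hφ hφs x)
  refine ⟨hu.1.1.1.restrict, h.trans_lt (ENNReal.mul_lt_top (by simp) ?_)⟩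
  exact ((hu.1.2.1.restrict D).mono_exponent (by simpa using hp.le)).2

/-- Sobolev inequality for the truncations, in terms of the measure of the level sets. Here `t` is
the reciprocal of the exponent of the gradient. -/
theorem MemW1pZero.exists_level_set_estimate (hp : 1 < p) (hD : volume D < ⊤) {t : ℝ}
    (htd : (d : ℝ)⁻¹ < t) (ht1 : t ≤ 1) (htp : p⁻¹ ≤ t) (hd : 0 < d) (hu : MemW1pZero p D u G) :
    ∃ s : NNReal, s ≠ 0 ∧ (s : ℝ)⁻¹ = t - (d : ℝ)⁻¹ ∧ ∃ C : NNReal, ∀ k, 0 ≤ k →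
      eLpNorm (fun x => _root_.excess k (u x)) s (volume.restrict D) ≠ ⊤ ∧
      (eLpNorm (fun x => _root_.excess k (u x)) s (volume.restrict D)).toReal ≤
        C * ((eLpNorm ({x | k < |u x|}.indicator G) (ENNReal.ofReal p)
          (volume.restrict D)).toReal *
            (volume.restrict D).real {x | k < |u x|} ^ (t - p⁻¹)) := by
  have hfin : IsFiniteMeasure (volume.restrict D) := ⟨by simpa using hD⟩
  have ht : 0 < t := lt_of_le_of_lt (by positivity) htd
  have hc : 0 < t - (d : ℝ)⁻¹ := sub_pos.2 htd
  have hr1 : 1 ≤ t⁻¹.toNNReal := by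
    rw [Real.one_le_toNNReal]
    exact (one_le_inv₀ ht).2 ht1
  have hrc : (t⁻¹.toNNReal : ℝ) = t⁻¹ := Real.coe_toNNReal _ (by positivity)
  have hsc : ((t - (d : ℝ)⁻¹)⁻¹.toNNReal : ℝ) = (t - (d : ℝ)⁻¹)⁻¹ :=
    Real.coe_toNNReal _ (by positivity)
  have hrp : (t⁻¹.toNNReal : ℝ) ≤ p := by
    rw [hrc]; exact inv_le_of_inv_le₀ (by linarith) htp
  refine ⟨(t - (d : ℝ)⁻¹)⁻¹.toNNReal, (Real.toNNReal_pos.2 (inv_pos.2 hc)).ne',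
    by rw [hsc, inv_inv], SNormLESNormFDerivOfEqConst ℝ (volume : Measure (Rd d)) t⁻¹.toNNReal,
    fun k hk => ?_⟩
  have hW := hu.excess hp hk
  have hHm := hW.1.2.1.restrict D
  have h1 := hW.eLpNorm_le hp hD (s := (t - (d : ℝ)⁻¹)⁻¹.toNNReal) hr1 hrp fun φ hφ hφs =>
    eLpNorm_le_eLpNorm_gradient hd hr1 (by rw [hsc, hrc, inv_inv, inv_inv]) hφ hφs
  have h2 : eLpNorm ({x | k < |u x|}.indicator G) (t⁻¹.toNNReal) (volume.restrict D)
      ≤ eLpNorm ({x | k < |u x|}.indicator G) (ENNReal.ofReal p) (volume.restrict D)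
        * (volume.restrict D) {x | k < |u x|} ^ (t - p⁻¹) := by
    refine (eLpNorm_le_mul_measure_rpow_of_support_subset (p := ENNReal.ofReal p) ?_ hHm.1
      Set.support_indicator_subset).trans_eq ?_
    · rw [ENNReal.le_ofReal_iff_toReal_le (by simp) (by linarith)]
      simpa only [ENNReal.coe_toReal] using hrp
    · rw [ENNReal.coe_toReal, hrc, ENNReal.toReal_ofReal (by linarith), one_div, one_div, inv_inv]
  have h3 := h1.trans (mul_le_mul_right h2 _)
  have hne : SNormLESNormFDerivOfEqConst ℝ (volume : Measure (Rd d)) t⁻¹.toNNReal *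
      (eLpNorm ({x | k < |u x|}.indicator G) (ENNReal.ofReal p) (volume.restrict D)
        * (volume.restrict D) {x | k < |u x|} ^ (t - p⁻¹)) ≠ ⊤ :=
    ENNReal.mul_ne_top ENNReal.coe_ne_top (ENNReal.mul_ne_top hHm.2.ne
      (ENNReal.rpow_ne_top_of_nonneg (by linarith) (measure_ne_top _ _)))
  refine ⟨ne_top_of_le_ne_top hne h3, (ENNReal.toReal_mono hne h3).trans_eq ?_⟩
  rw [ENNReal.toReal_mul, ENNReal.toReal_mul, ← ENNReal.toReal_rpow, ENNReal.coe_toReal,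
    measureReal_def]

/-- Use the `L¹` Sobolev inequality (`t = 1`) and bound the truncated gradient by all of `G`. The
exponents are then `c = 1 - 1/d` and `b = 1 - 1/p`, and `c < b` because `d < p`. -/
theorem memLp_top_of_memW1pZero_of_dim_lt (hp : 1 < p) (hD : volume D < ⊤) (hd : 2 ≤ d)
    (hdp : (d : ℝ) < p) (hu : MemW1pZero p D u G) : MemLp u ⊤ (volume.restrict D) := by
  have hfin : IsFiniteMeasure (volume.restrict D) := ⟨by simpa using hD⟩
  have hd2 : (2 : ℝ) ≤ d := by exact_mod_cast hd
  have hd1 : (d : ℝ)⁻¹ < 1 := inv_lt_one_of_one_lt₀ (by linarith)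
  obtain ⟨s, hs0, hs, C, h⟩ := hu.exists_level_set_estimate hp hD hd1 le_rfl
    (inv_le_one_of_one_le₀ hp.le) (by omega)
  have hGm := hu.1.2.1.restrict D
  refine memLp_top_of_level_set_decay hu.1.1.1.restrict
    (K := C * (eLpNorm G (ENNReal.ofReal p) (volume.restrict D)).toReal) (c := 1 - (d : ℝ)⁻¹)
    (b := 1 - p⁻¹) (by positivity) (by linarith)
    (sub_lt_sub_left (inv_strictAnti₀ (by linarith) hdp) _) fun k l hk hkl => ?_
  obtain ⟨hfinN, hN⟩ := h k hk
  have h1 := sub_mul_measureReal_rpow_le hu.1.1.1.restrict hs0 hk hkl.le hfinN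
  rw [hs] at h1
  refine h1.trans (hN.trans ?_)
  rw [mul_assoc]
  gcongr
  · exact hGm.2.ne
  · exact eLpNorm_indicator_le _

theorem memLp_top_of_isWeakSolution_of_le_dim (hp : 1 < p) (hD : volume D < ⊤) (hpd : p ≤ d)
    {q : ℝ≥0∞} (hq1 : 1 ≤ q) (hq : (d : ℝ≥0∞) / ENNReal.ofReal p < q) {f : Rd d → ℝ}
    (hf : MemLp f q (volume.restrict D)) (hu : IsWeakSolution p D μ f u) :
    MemLp u ⊤ (volume.restrict D) := by
  have hfin : IsFiniteMeasure (volume.restrict D) := ⟨by simpa using hD⟩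
  obtain ⟨G, huG, heq⟩ := hu
  have hp0 : 0 < p := by linarith
  have hd0 : (0 : ℝ) < d := by linarith
  have hd0' : 0 < d := by exact_mod_cast hd0
  have hd1 : (d : ℝ)⁻¹ < 1 := inv_lt_one_of_one_lt₀ (by linarith)
  have hq0 : q ≠ 0 := (one_pos.trans_le hq1).ne'
  -- The reciprocal of `q`, equal to `0` when `q = ∞`.
  set κ : ℝ := (q⁻¹).toReal with hκ
  have hκ0 : 0 ≤ κ := ENNReal.toReal_nonneg
  have hκd : κ < p * (d : ℝ)⁻¹ := by
    have h1 := ENNReal.inv_lt_inv.2 hq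
    have h2 := (ENNReal.toReal_lt_toReal (by simpa using hq0) (by
      simp; omega)).2 h1
    rwa [← hκ, ENNReal.toReal_inv, ENNReal.toReal_div, ENNReal.toReal_natCast,
      ENNReal.toReal_ofReal hp0.le, inv_div, div_eq_mul_inv] at h2
  have hpd' : (d : ℝ)⁻¹ ≤ p⁻¹ := inv_anti₀ hp0 hpd
  have hpd1 : p * (d : ℝ)⁻¹ ≤ 1 := by
    rw [← div_eq_mul_inv]; exact div_le_one_of_le₀ hpd hd0.le
  -- The largest `t ≤ 1` with `1/s = t - 1/d ≤ 1 - κ = 1/q'`, so that the `L^{q'}` norm in the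
  -- energy estimate is controlled by the `L^s` norm.
  set t : ℝ := min 1 (1 - κ + (d : ℝ)⁻¹) with ht
  have htd : (d : ℝ)⁻¹ < t := lt_min hd1 (by linarith)
  have htp : p⁻¹ ≤ t := by
    refine le_min (inv_le_one_of_one_le₀ hp.le) ?_
    have h1 : p * p⁻¹ = 1 := mul_inv_cancel₀ hp0.ne'
    nlinarith [mul_nonneg (sub_nonneg.2 hp.le) (sub_nonneg.2 hpd')]
  have ht2 : t ≤ 1 - κ + (d : ℝ)⁻¹ := min_le_right _ _
  obtain ⟨s, hs0, hs, C, h⟩ := huG.1.exists_level_set_estimate hp hD htd (min_le_left _ _) htp hd0'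
  have : ENNReal.HolderConjugate q q.conjExponent := .conjExponent hq1
  have hq'0 : (q.conjExponent)⁻¹.toReal = 1 - κ := by
    have := ENNReal.HolderConjugate.inv_add_inv_eq_one q q.conjExponent
    have h2 := congrArg ENNReal.toReal this
    rw [ENNReal.toReal_add (by simpa using hq0)
      (by simpa using (ENNReal.HolderConjugate.ne_zero q.conjExponent q)), ENNReal.toReal_one] at h2
    linarith
  have hc : 0 < t - (d : ℝ)⁻¹ := sub_pos.2 htd
  have he₂ : 0 ≤ 1 - κ - (t - (d : ℝ)⁻¹) := by linarith
  have hq's : q.conjExponent ≤ s := by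
    rw [← ENNReal.inv_le_inv, ← ENNReal.toReal_le_toReal (by simpa using hs0)
      (by simpa using (ENNReal.HolderConjugate.ne_zero q.conjExponent q)), hq'0,
      ENNReal.toReal_inv, ENNReal.coe_toReal, hs]
    linarith
  refine memLp_top_of_level_set_decay huG.1.1.1.1.restrict
    (K := ((C : ℝ) ^ p * (eLpNorm f q (volume.restrict D)).toReal) ^ (p - 1)⁻¹)
    (c := t - (d : ℝ)⁻¹)
    (b := (p * (t - p⁻¹) + (1 - κ - (t - (d : ℝ)⁻¹))) / (p - 1)) (by positivity) hc ?_
    fun k l hk hkl => ?_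
  -- After clearing `p - 1`, every term in `t` cancels and `c < b` becomes `κ < p / d`.
  · rw [lt_div_iff₀ (by linarith)]
    have h1 : p * p⁻¹ = 1 := mul_inv_cancel₀ hp0.ne'
    nlinarith
  obtain ⟨hfinN, hN⟩ := h k hk
  have h1 := sub_mul_measureReal_rpow_le huG.1.1.1.1.restrict hs0 hk hkl.le hfinN
  rw [hs] at h1
  refine h1.trans (rpow_bound_of_energy hp ENNReal.toReal_nonneg ENNReal.toReal_nonneg
    measureReal_nonneg C.2 ENNReal.toReal_nonneg (by linarith) he₂ hN ?_)
  have hE := energy_estimate (q' := q.conjExponent) hp hf huG hk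
    (heq _ _ (huG.excess hp hk))
  have hS := eLpNorm_le_mul_measure_rpow_of_support_subset (S := {x | k < |u x|}) hq's
    (huG.1.excess hp hk).1.1.1.restrict (ν := volume.restrict D) (fun x hx => by
      by_contra hx'
      exact hx (excess_of_abs_le (not_lt.1 hx')))
  rw [one_div, one_div, ← ENNReal.toReal_inv, hq'0, ENNReal.coe_toReal, hs] at hS
  have h3 := hE.trans (mul_le_mul_right hS _)
  have h4 := ENNReal.toReal_mono (ENNReal.mul_ne_top hf.2.ne (ENNReal.mul_ne_top hfinN
      (ENNReal.rpow_ne_top_of_nonneg he₂ (measure_ne_top _ _)))) h3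
  rwa [ENNReal.toReal_mul, ENNReal.toReal_mul, ← ENNReal.toReal_rpow, ← ENNReal.toReal_rpow] at h4

end WeakSolution

theorem lemma3p6 {d : ℕ} (p : ℝ) (hp : 1 < p)
    (D : Set (Rd d)) (hD : IsOpen D) (hDfin : volume D < ⊤)
    (μ : Measure (Rd d)) (hμ : IsCapacitary p μ)
    (q : ℝ≥0∞) (hq1 : 1 ≤ q) (hq : (d : ℝ≥0∞) / ENNReal.ofReal p < q)
    (f : Rd d → ℝ) (hf : MemLp f q (volume.restrict D))
    (u : Rd d → ℝ) (hu : IsWeakSolution p D μ f u) :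
    MemLp u ⊤ (volume.restrict D) := by
  rcases le_or_gt p d with hpd | hpd
  · exact memLp_top_of_isWeakSolution_of_le_dim hp hDfin hpd hq1 hq hf hu
  obtain ⟨G, ⟨hW, -⟩, -⟩ := hu
  -- Low dimensions are separate because the level-set estimate needs `1/d < t ≤ 1`, impossible for
  -- `d = 1`; for `d = 0` the space is a single point.
  obtain rfl | rfl | hd : d = 0 ∨ d = 1 ∨ 2 ≤ d := by omega
  · exact memLp_top_of_bound hW.1.1.1.restrict ‖u 0‖
      (Eventually.of_forall fun x => by rw [Subsingleton.elim x 0])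
  · exact memLp_top_of_memW1pZero_dim_one hp hDfin hW
  · exact memLp_top_of_memW1pZero_of_dim_lt hp hDfin hd hpd hW
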